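/- Let $X$ and $Y$ be complex Banach spaces and let $A\in\mathcal B(X)$ and $B\in\mathcal B(Y)$ be bounded linear operators such that $A$, $B$ and their Banach-space adjoints $A^*\in\mathcal B(X^*)$, $B^*\in\mathcal B(Y^*)$ all have the SVEP. Then for every $C\in\mathcal B(Y,X)$ the operator $M_C=\begin{pmatrix}A&C\\0&B\end{pmatrix}$ on $X\oplus Y$, i.e. $M_C(x,y)=(Ax+Cy,By)$, satisfies $$\sigma_{gK}(M_C)=\sigma_{gK}(A)\cup\sigma_{gK}(B).$$ Here, for a bounded linear operator $T$ on a complex Banach space $E$: $T$ has the SVEP (single-valued extension property) if for every $\lambda_0\in\mathbb C$ and every open neighbourhood $U\subseteq\mathbb C$ of $\lambda_0$, the only analytic function $f:U\to E$ with $(T-zI)f(z)=0$ for all $z\in U$ is $f\equiv0$. $T$ is semi-regular if its range is closed and $\ker T\subseteq\bigcap_{n\ge0}T^n(E)$. $T$ is quasinilpotent if its spectral radius is $0$. $T$ is pseudo-Fredholm (admits a generalized Kato decomposition) if there are closed $T$-invariant subspaces $M,N$ of $E$ with $E=M\oplus N$ such that the restriction $T|_M$ is semi-regular and $T|_N$ is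 quasinilpotent. Finally $\sigma_{gK}(T)=\{\lambda\in\mathbb C: T-\lambda I \text{ is not pseudo-Fredholm}\}$. -/

import Mathlib

namespace GenKato

/-- `T` has the single-valued extension property at `z₀`: for every open neighbourhood `U` of `z₀`,
the only analytic `f : U → E` with `(T - z) f(z) = 0` on `U` is `f ≡ 0`. -/
def HasSVEPAt {E : Type*} [NormedAddCommGroup E] [NormedSpace ℂ E]
    (T : E →L[ℂ] E) (z₀ : ℂ) : Prop :=
  ∀ U : Set ℂ, IsOpen U → z₀ ∈ U → ∀ f : ℂ → E, AnalyticOnNhd ℂ f U →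
    (∀ z ∈ U, (T - z • (1 : E →L[ℂ] E)) (f z) = 0) → ∀ z ∈ U, f z = 0

/-- The single-valued extension property (at every complex number). -/
def HasSVEP {E : Type*} [NormedAddCommGroup E] [NormedSpace ℂ E] (T : E →L[ℂ] E) : Prop :=
  ∀ z₀ : ℂ, HasSVEPAt T z₀

/-- The Banach-space adjoint `T* : E* → E*`, `T* φ = φ ∘ T`. -/
noncomputable def adjoint {E : Type*} [NormedAddCommGroup E] [NormedSpace ℂ E]
    (T : E →L[ℂ] E) : StrongDual ℂ E →L[ℂ] StrongDual ℂ E :=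
  T.precomp ℂ

/-- Semi-regular (Kato) operator: closed range, and the kernel lies in the hyper-range. -/
def IsSemiRegular {E : Type*} [NormedAddCommGroup E] [NormedSpace ℂ E] (T : E →L[ℂ] E) : Prop :=
  IsClosed (Set.range T) ∧ ∀ x : E, T x = 0 → ∀ n : ℕ, x ∈ Set.range (T ^ n)

/-- Quasinilpotent operator: the spectral radius is zero. -/
def IsQuasinilpotent {E : Type*} [NormedAddCommGroup E] [NormedSpace ℂ E]
    (T : E →L[ℂ] E) : Prop :=
  spectralRadius ℂ T = 0

/-- Pseudo-Fredholm operator: `T` admits a generalized Kato decomposition `(M, N)`. -/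
def IsPseudoFredholm {E : Type*} [NormedAddCommGroup E] [NormedSpace ℂ E]
    (T : E →L[ℂ] E) : Prop :=
  ∃ (M N : Submodule ℂ E) (hM : Set.MapsTo T M M) (hN : Set.MapsTo T N N),
    IsClosed (M : Set E) ∧ IsClosed (N : Set E) ∧ IsCompl M N ∧
      IsSemiRegular (T.restrict hM) ∧ IsQuasinilpotent (T.restrict hN)

/-- The generalized Kato (pseudo-Fredholm) spectrum. -/
def gKSpectrum {E : Type*} [NormedAddCommGroup E] [NormedSpace ℂ E] (T : E →L[ℂ] E) : Set ℂ :=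
  {z : ℂ | ¬ IsPseudoFredholm (T - z • (1 : E →L[ℂ] E))}

/-- The operator matrix `M_C = [[A, C], [0, B]]` on `X ⊕ Y`, that is `(x, y) ↦ (A x + C y, B y)`. -/
noncomputable def upperTriangular {X Y : Type*} [NormedAddCommGroup X] [NormedSpace ℂ X]
    [NormedAddCommGroup Y] [NormedSpace ℂ Y]
    (A : X →L[ℂ] X) (B : Y →L[ℂ] Y) (C : Y →L[ℂ] X) : (X × Y) →L[ℂ] (X × Y) :=
  (A.coprod C).prod (B.comp (ContinuousLinearMap.snd ℂ X Y))

end GenKato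

/-! When `T` and its adjoint have the SVEP, `T - λ` is pseudo-Fredholm exactly when `λ` is not an
accumulation point of the spectrum of `T` (`isPseudoFredholm_iff_eventually`). In a generalized Kato
decomposition the semi-regular part inherits both SVEPs, which forces it to be bijective; it stays
invertible under small shifts, while the quasinilpotent part is invertible off `0`. Conversely, the
Riesz idempotent at a non-accumulation point splits the space into an invertible and a
quasinilpotent part.

The matrix inherits both SVEPs from its diagonal, and the SVEP of `B` makes `M_C - z` invertible iff
`A - z` and `B - z` both are (`isUnit_upperTriangular_iff`). Hence the accumulation points of the
spectrum of `M_C` are those of `A` together with those of `B`. -/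

open Filter Topology Metric

namespace GenKato

variable {E F : Type*} [NormedAddCommGroup E] [NormedSpace ℂ E]
  [NormedAddCommGroup F] [NormedSpace ℂ F]

/-! ### Laurent coefficients of the resolvent and the Riesz idempotent -/

/-- The Laurent coefficients `(2πi)⁻¹ ∮ z ^ k R(z) dz` of the resolvent `R` of `a` at `0`. -/
noncomputable def laurentCoeff {A : Type*} [NormedRing A] [NormedAlgebra ℂ A]
    (a : A) (r : ℝ) (k : ℤ) : A :=
  (2 * Real.pi * Complex.I : ℂ)⁻¹ • ∮ z in C(0, r), z ^ k • resolvent a z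

section Laurent

variable {A : Type*} [NormedRing A] [NormedAlgebra ℂ A] [CompleteSpace A] {a : A} {r : ℝ}

theorem continuousOn_zpow_smul_resolvent
    (h : ∀ z : ℂ, z ≠ 0 → ‖z‖ ≤ r → z ∈ resolventSet ℂ a) (k : ℤ) :
    ContinuousOn (fun z : ℂ => z ^ k • resolvent a z) {z | z ≠ 0 ∧ ‖z‖ ≤ r} := fun z hz =>
  ((differentiableAt_zpow (m := k) |>.2 (Or.inl hz.1)).smul
    (spectrum.hasDerivAt_resolvent_const_left
      (h z hz.1 hz.2)).differentiableAt).continuousAt.continuousWithinAt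

theorem sphere_subset_punctured {ρ : ℝ} (hρ : 0 < ρ) (hr : ρ ≤ r) :
    sphere (0 : ℂ) ρ ⊆ {z | z ≠ 0 ∧ ‖z‖ ≤ r} := fun z hz => by
  rw [mem_sphere_zero_iff_norm] at hz
  exact ⟨norm_pos_iff.1 (hz ▸ hρ), hz.trans_le hr⟩

theorem laurentCoeff_eq_of_le (h : ∀ z : ℂ, z ≠ 0 → ‖z‖ ≤ r → z ∈ resolventSet ℂ a)
    {ρ : ℝ} (hρ : 0 < ρ) (hr : ρ ≤ r) (k : ℤ) : laurentCoeff a r k = laurentCoeff a ρ k := by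
  unfold laurentCoeff
  congr 1
  refine Complex.circleIntegral_eq_of_differentiable_on_annulus_off_countable hρ hr
    Set.countable_empty ((continuousOn_zpow_smul_resolvent h k).mono ?_) ?_
  · rintro z ⟨h1, h2⟩
    rw [mem_closedBall_zero_iff] at h1
    rw [mem_ball_zero_iff, not_lt] at h2
    exact ⟨norm_pos_iff.1 (hρ.trans_le h2), h1⟩
  · rintro z ⟨⟨h1, h2⟩, -⟩
    rw [mem_ball_zero_iff] at h1
    rw [mem_closedBall_zero_iff, not_le] at h2
    have hz : z ≠ 0 := norm_pos_iff.1 (hρ.trans h2)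
    exact (differentiableAt_zpow.2 (Or.inl hz)).smul
      (spectrum.hasDerivAt_resolvent_const_left (h z hz h1.le)).differentiableAt

/-- The radius `ρ` is free because the coefficients do not depend on the circle: a small `ρ` gives
fast geometric decay as `k → ∞`. -/
theorem exists_norm_laurentCoeff_le (h : ∀ z : ℂ, z ≠ 0 → ‖z‖ ≤ r → z ∈ resolventSet ℂ a)
    {ρ : ℝ} (hρ : 0 < ρ) (hr : ρ ≤ r) :
    ∃ C, 0 ≤ C ∧ ∀ k : ℤ, ‖laurentCoeff a r k‖ ≤ C * ρ ^ k := by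
  obtain ⟨K, hK⟩ := (isCompact_sphere (0 : ℂ) ρ).exists_bound_of_continuousOn
    ((continuousOn_zpow_smul_resolvent h 0).mono (sphere_subset_punctured hρ hr))
  refine ⟨ρ * max K 0, by positivity, fun k => ?_⟩
  rw [laurentCoeff_eq_of_le h hρ hr]
  refine (circleIntegral.norm_two_pi_i_inv_smul_integral_le_of_norm_le_const hρ.le
    (C := ρ ^ k * max K 0) fun z hz => ?_).trans_eq (by ring)
  have hz' := mem_sphere_zero_iff_norm.1 hz
  have := hK z hz
  rw [zpow_zero, one_smul] at this
  rw [norm_smul, norm_zpow, hz']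
  gcongr
  exact this.trans (le_max_left _ _)

theorem circleIntegrable_zpow_smul_resolvent
    (h : ∀ z : ℂ, z ≠ 0 → ‖z‖ ≤ r → z ∈ resolventSet ℂ a) (hr : 0 < r) (k : ℤ) :
    CircleIntegrable (fun z : ℂ => z ^ k • resolvent a z) 0 r :=
  ((continuousOn_zpow_smul_resolvent h k).mono
    (sphere_subset_punctured hr le_rfl)).circleIntegrable hr.le

theorem _root_.ContinuousLinearMap.circleIntegral_comp_comm {A B : Type*}
    [NormedAddCommGroup A] [NormedSpace ℂ A] [CompleteSpace A]
    [NormedAddCommGroup B] [NormedSpace ℂ B] [CompleteSpace B]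
    (L : A →L[ℂ] B) {f : ℂ → A} {c : ℂ} {r : ℝ} (hf : CircleIntegrable f c r) :
    (∮ z in C(c, r), L (f z)) = L (∮ z in C(c, r), f z) := by
  unfold circleIntegral
  rw [← L.intervalIntegral_comp_comm hf.out]
  simp

theorem commute_laurentCoeff (h : ∀ z : ℂ, z ≠ 0 → ‖z‖ ≤ r → z ∈ resolventSet ℂ a)
    (hr : 0 < r) (k : ℤ) : Commute a (laurentCoeff a r k) := by
  have hi := circleIntegrable_zpow_smul_resolvent h hr k
  have h1 := (ContinuousLinearMap.mul ℂ A a).circleIntegral_comp_comm hi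
  have h2 := ((ContinuousLinearMap.mul ℂ A).flip a).circleIntegral_comp_comm hi
  simp only [ContinuousLinearMap.mul_apply', ContinuousLinearMap.flip_apply] at h1 h2
  unfold laurentCoeff
  refine Commute.smul_right ?_ _
  rw [commute_iff_eq, ← h1, ← h2]
  refine circleIntegral.integral_congr hr.le fun z hz => ?_
  obtain ⟨hz0, hzr⟩ := sphere_subset_punctured hr le_rfl hz
  simp only [mul_smul_comm, smul_mul_assoc]
  congr 1
  obtain ⟨u, hu⟩ : IsUnit (algebraMap ℂ A z - a) := h z hz0 hzr
  have hau : Commute a u := by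
    rw [hu]
    exact (Algebra.commute_algebraMap_right z a).sub_right (Commute.refl a)
  rw [resolvent, ← hu, Ring.inverse_unit]
  exact hau.units_inv_right

/-- Integrate `a R(z) = z R(z) - 1` against `z ^ k`; the constant term has a residue only for `k =
-1`. -/
theorem mul_laurentCoeff (h : ∀ z : ℂ, z ≠ 0 → ‖z‖ ≤ r → z ∈ resolventSet ℂ a)
    (hr : 0 < r) (k : ℤ) :
    a * laurentCoeff a r k = laurentCoeff a r (k + 1) - if k = -1 then 1 else 0 := by
  have hi := circleIntegrable_zpow_smul_resolvent h hr k
  have h1 := (ContinuousLinearMap.mul ℂ A a).circleIntegral_comp_comm hi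
  simp only [ContinuousLinearMap.mul_apply'] at h1
  have h2 : (∮ z in C(0, r), a * (z ^ k • resolvent a z)) =
      ∮ z in C(0, r), (z ^ (k + 1) • resolvent a z - z ^ k • (1 : A)) := by
    refine circleIntegral.integral_congr hr.le fun z hz => ?_
    obtain ⟨hz0, hzr⟩ := sphere_subset_punctured hr le_rfl hz
    have hu : (algebraMap ℂ A z - a) * resolvent a z = 1 :=
      Ring.mul_inverse_cancel _ (h z hz0 hzr)
    rw [sub_mul, sub_eq_iff_eq_add, ← Algebra.smul_def] at hu
    simp only [mul_smul_comm]
    rw [zpow_add_one₀ hz0, mul_smul, hu, smul_add, add_sub_cancel_left]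
  have h3 : CircleIntegrable (fun z : ℂ => z ^ k • (1 : A)) 0 r :=
    ContinuousOn.circleIntegrable hr.le fun z hz =>
      ((differentiableAt_zpow.2 (Or.inl (sphere_subset_punctured hr le_rfl hz).1)).smul_const
        _).continuousAt.continuousWithinAt
  rw [circleIntegral.integral_sub (circleIntegrable_zpow_smul_resolvent h hr (k + 1)) h3,
    circleIntegral.integral_smul_const] at h2
  unfold laurentCoeff
  rw [mul_smul_comm, ← h1, h2, smul_sub]
  congr 1
  split_ifs with hk
  · subst hk
    have := circleIntegral.integral_sub_center_inv 0 hr.ne'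
    simp only [sub_zero] at this
    simp only [zpow_neg_one, this]
    rw [smul_smul, inv_mul_cancel₀ (by simp [Real.pi_ne_zero]), one_smul]
  · have := circleIntegral.integral_sub_zpow_of_ne hk 0 0 r
    simp only [sub_zero] at this
    rw [this, zero_smul, smul_zero]

/-- The Riesz decomposition of an element of a Banach algebra for which `0` is not an accumulation
point of the spectrum: `p` is the spectral idempotent, and `-s` inverts `a` modulo `p`. -/
theorem exists_riesz_idempotent (ha : ∀ᶠ z : ℂ in 𝓝[≠] 0, z ∈ resolventSet ℂ a) :
    ∃ p s : A, Commute a p ∧ Commute a s ∧ p * p = p ∧ p * s = 0 ∧ a * s = p - 1 ∧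
      ∀ ε > 0, ∃ C : ℝ, 0 ≤ C ∧ ∀ n : ℕ, ‖a ^ n * p‖ ≤ C * ε ^ n := by
  obtain ⟨r', hr', hball⟩ := Metric.mem_nhdsWithin_iff.1 ha
  obtain ⟨r, hr, hrr'⟩ := exists_between hr'
  have h : ∀ z : ℂ, z ≠ 0 → ‖z‖ ≤ r → z ∈ resolventSet ℂ a := fun z hz hzr =>
    hball ⟨mem_ball_zero_iff.2 (hzr.trans_lt hrr'), hz⟩
  have hpow : ∀ n : ℕ, a ^ n * laurentCoeff a r 0 = laurentCoeff a r n := fun n => by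
    induction n with
    | zero => simp
    | succ n ih =>
      rw [pow_succ', mul_assoc, ih, mul_laurentCoeff h hr, if_neg (by omega), sub_zero]
      push_cast; rfl
  have hneg : ∀ n : ℕ, a ^ n * laurentCoeff a r (-n - 1) = laurentCoeff a r (-1) := fun n => by
    induction n with
    | zero => simp
    | succ n ih =>
      rw [pow_succ, mul_assoc, mul_laurentCoeff h hr, if_neg (by push_cast; omega), sub_zero, ← ih]
      congr 2; push_cast; ring
  have has : a * laurentCoeff a r (-1) = laurentCoeff a r 0 - 1 := by
    rw [mul_laurentCoeff h hr]; simp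
  -- Moving `a ^ n` across the product turns it into coefficient `n` times coefficient `-n - 1`.
  -- Estimating these on the radii `r / 2` and `r` leaves a factor `2⁻ⁿ`.
  have hps : laurentCoeff a r 0 * laurentCoeff a r (-1) = 0 := by
    obtain ⟨C, hC, hCb⟩ := exists_norm_laurentCoeff_le h (half_pos hr) (half_le_self hr.le)
    obtain ⟨D, hD, hDb⟩ := exists_norm_laurentCoeff_le h hr le_rfl
    have hlim : Tendsto (fun n : ℕ => C * D * r⁻¹ * (1 / 2 : ℝ) ^ n) atTop (𝓝 0) := by
      simpa using (tendsto_pow_atTop_nhds_zero_of_lt_one (r := (1 / 2 : ℝ)) (by norm_num)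
        (by norm_num)).const_mul (C * D * r⁻¹)
    refine norm_le_zero_iff.1 (ge_of_tendsto' hlim fun n => ?_)
    rw [← hneg n, ← mul_assoc, ← ((commute_laurentCoeff h hr 0).pow_left n).eq, hpow n]
    calc _ ≤ ‖laurentCoeff a r n‖ * ‖laurentCoeff a r (-n - 1)‖ := norm_mul_le _ _
      _ ≤ (C * (r / 2) ^ (n : ℤ)) * (D * r ^ (-n - 1 : ℤ)) := by
        gcongr
        exacts [hCb _, hDb _]
      _ = _ := by
        rw [zpow_sub₀ hr.ne', zpow_neg, zpow_natCast, zpow_natCast, zpow_one, div_pow, div_pow]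
        field_simp
        simp
  refine ⟨laurentCoeff a r 0, laurentCoeff a r (-1), commute_laurentCoeff h hr _,
    commute_laurentCoeff h hr _, ?_, hps, has, fun ε hε => ?_⟩
  · have : laurentCoeff a r 0 * (a * laurentCoeff a r (-1)) = 0 := by
      rw [← mul_assoc, ← (commute_laurentCoeff h hr 0).eq, mul_assoc, hps, mul_zero]
    rwa [has, mul_sub, mul_one, sub_eq_zero] at this
  · obtain ⟨C, hC, hCb⟩ := exists_norm_laurentCoeff_le h (lt_min hε hr) (min_le_right ε r)
    refine ⟨C, hC, fun n => ?_⟩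
    rw [hpow n]
    refine (hCb n).trans ?_
    rw [zpow_natCast]
    have := lt_min hε hr
    gcongr
    exact min_le_left _ _

end Laurent

/-! ### Transfer of the SVEP, and surjective operators -/

theorem HasSVEPAt.of_intertwining {T : E →L[ℂ] E} {S : F →L[ℂ] F} {z₀ : ℂ} (hT : HasSVEPAt T z₀)
    (J : F →L[ℂ] E) (hJ : Function.Injective J) (hJS : ∀ x, J (S x) = T (J x)) :
    HasSVEPAt S z₀ := fun U hU hz f hf hfz z hzU => by
  refine hJ ?_
  rw [map_zero]
  refine hT U hU hz (fun z => J (f z)) (fun z hz => J.analyticAt _ |>.comp (hf z hz))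
    (fun z hz => ?_) z hzU
  have := congrArg J (hfz z hz)
  simpa [hJS] using this

theorem HasSVEP.sub_smul_one {T : E →L[ℂ] E} (hT : HasSVEP T) (w : ℂ) :
    HasSVEP (T - w • (1 : E →L[ℂ] E)) := fun z₀ U hU hz f hf hfz z hzU => by
  have := hT (z₀ + w) ((fun u => u - w) ⁻¹' U) (hU.preimage (by fun_prop)) (by simpa using hz)
    (fun u => f (u - w))
    (fun u hu => (hf (u - w) hu).comp (f := fun u => u - w)
      (analyticAt_id.sub analyticAt_const))
    (fun u hu => by
      have := hfz (u - w) hu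
      rw [sub_sub, ← add_smul, add_sub_cancel] at this
      exact this) (z + w) (by simpa using hzU)
  simpa using this

/-- SVEP at `0` excludes bounded backward orbits of kernel vectors. -/
theorem HasSVEPAt.eq_zero_of_backward_orbit [CompleteSpace E] {T : E →L[ℂ] E}
    (hT : HasSVEPAt T 0) {K : Set E} {c : ℝ}
    (hK : ∀ y ∈ K, ∃ x ∈ K, T x = y ∧ ‖x‖ ≤ c * ‖y‖) {x₀ : E} (hx₀ : x₀ ∈ K) (h0 : T x₀ = 0) :
    x₀ = 0 := by
  choose! g hgK hgT hgc using hK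
  let x : ℕ → E := fun n => g^[n] x₀
  have hxs : ∀ n, x (n + 1) = g (x n) := fun n => Function.iterate_succ_apply' g n x₀
  have hxK : ∀ n, x n ∈ K := fun n => by
    induction n with
    | zero => exact hx₀
    | succ n ih => rw [hxs]; exact hgK _ ih
  have hTx : ∀ n, T (x (n + 1)) = x n := fun n => by rw [hxs, hgT _ (hxK n)]
  set d : ℝ := max c 1 with hd
  have hd0 : 0 < d := lt_of_lt_of_le one_pos (le_max_right _ _)
  have hxn : ∀ n, ‖x n‖ ≤ d ^ n * ‖x₀‖ := fun n => by
    induction n with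
    | zero => simp [x]
    | succ n ih =>
      rw [hxs, pow_succ', mul_assoc]
      refine (hgc _ (hxK n)).trans ?_
      exact mul_le_mul (le_max_left _ _) ih (norm_nonneg _) hd0.le
  have hb : ∀ (n : ℕ) (z : ℂ), z ∈ ball (0 : ℂ) (1 / (2 * d)) →
      ‖z ^ n • x n‖ ≤ (1 / 2) ^ n * ‖x₀‖ := fun n z hz => by
    rw [mem_ball_zero_iff] at hz
    rw [norm_smul, norm_pow]
    calc ‖z‖ ^ n * ‖x n‖ ≤ (1 / (2 * d)) ^ n * (d ^ n * ‖x₀‖) := by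
          gcongr
          exact hxn n
      _ = _ := by
          rw [← mul_assoc, ← mul_pow]
          congr 2
          field_simp
  have hs : Summable fun n : ℕ => (1 / 2 : ℝ) ^ n * ‖x₀‖ :=
    (summable_geometric_of_lt_one (by norm_num) (by norm_num)).mul_right _
  have hmem : (0 : ℂ) ∈ ball (0 : ℂ) (1 / (2 * d)) := mem_ball_self (by positivity)
  -- The series `f(z) = ∑ zⁿ xₙ` telescopes under `T - z` to `T x₀ = 0`, and `f(0) = x₀`.
  have hdiff : DifferentiableOn ℂ (fun z : ℂ => ∑' n, z ^ n • x n) (ball 0 (1 / (2 * d))) :=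
    Complex.differentiableOn_tsum_of_summable_norm hs
      (fun n => by fun_prop) isOpen_ball hb
  have := hT _ isOpen_ball hmem _ (hdiff.analyticOnNhd isOpen_ball) (fun z hz => ?_) 0 hmem
  · rw [tsum_eq_single 0 (fun n hn => by simp [hn])] at this
    simpa [x] using this
  · have hsum : Summable fun n : ℕ => z ^ n • x n :=
      Summable.of_norm_bounded hs fun n => hb n z hz
    simp only [sub_apply, smul_apply,
      one_apply_eq_self]
    rw [T.map_tsum hsum, (hsum.mapL T).tsum_eq_zero_add, ← tsum_const_smul'' z, sub_eq_zero]
    simp only [map_smul, hTx, pow_succ', mul_smul]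
    simp [x, h0]

/-- A surjective operator with the SVEP at `0` is injective. -/
theorem HasSVEPAt.injective_of_surjective [CompleteSpace E] {T : E →L[ℂ] E}
    (hT : HasSVEPAt T 0) (hs : Function.Surjective T) : Function.Injective T := by
  obtain ⟨c, -, hc⟩ := T.exists_preimage_norm_le hs
  refine (injective_iff_map_eq_zero T).2 fun x hx =>
    hT.eq_zero_of_backward_orbit (K := Set.univ) (c := c) (fun y _ => ?_) trivial hx
  obtain ⟨x, h1, h2⟩ := hc y
  exact ⟨x, trivial, h1, h2⟩

/-! ### Semi-regular operators with the SVEP -/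

/-- An operator with closed range maps closed subspaces containing the kernel to closed sets. -/
theorem isClosed_image_of_ker_le [CompleteSpace E] [CompleteSpace F] (T : E →L[ℂ] F)
    (hT : IsClosed (Set.range T)) (K : Submodule ℂ E) (hK : IsClosed (K : Set E))
    (hker : ∀ x, T x = 0 → x ∈ K) : IsClosed (T '' K) := by
  have hR : IsClosed (T.range : Set F) := hT
  have : CompleteSpace T.range := hR.completeSpace_coe
  have hsurj : Function.Surjective T.rangeRestrict := by
    rintro ⟨_, x, rfl⟩; exact ⟨x, rfl⟩
  have hq := (T.rangeRestrict.isOpenMap hsurj).isQuotientMap T.rangeRestrict.continuous hsurj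
  -- Containing the kernel makes `K` saturated for the quotient map onto the range.
  have hpre : T.rangeRestrict ⁻¹' (T.rangeRestrict '' K) = K := by
    refine Set.Subset.antisymm ?_ (Set.subset_preimage_image _ _)
    rintro x ⟨y, hy, hxy⟩
    have h2 : T y = T x := congrArg Subtype.val hxy
    have h3 := hker (x - y) (by rw [map_sub, h2, sub_self])
    simpa using K.add_mem h3 hy
  have hcl : IsClosed (T.rangeRestrict '' K) := by
    rw [← hq.isClosed_preimage, hpre]; exact hK
  have := hR.isClosedEmbedding_subtypeVal.isClosedMap _ hcl
  rwa [Set.image_image] at this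

/-- A semi-regular operator with the SVEP at `0` is injective. -/
theorem IsSemiRegular.injective [CompleteSpace E] {T : E →L[ℂ] E} (h : IsSemiRegular T)
    (hT : HasSVEPAt T 0) : Function.Injective T := by
  have hcl : ∀ n : ℕ, IsClosed ((T ^ n).range : Set E) := fun n => by
    induction n with
    | zero => simp [ContinuousLinearMap.one_def]
    | succ n ih =>
      have := isClosed_image_of_ker_le T h.1 _ ih (fun x hx => h.2 x hx n)
      convert this using 1
      ext x
      simp [pow_succ']
  let K : Submodule ℂ E := ⨅ n : ℕ, (T ^ n).range
  have hmemK : ∀ x, x ∈ K ↔ ∀ n : ℕ, ∃ y, (T ^ n) y = x := fun x => by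
    simp only [K, Submodule.mem_iInf]; rfl
  have hKcl : IsClosed (K : Set E) := by
    simp only [K, Submodule.coe_iInf]
    exact isClosed_iInter hcl
  have : CompleteSpace K := hKcl.completeSpace_coe
  have hmaps : ∀ x ∈ K, T x ∈ K := fun x hx => by
    rw [hmemK] at hx ⊢
    intro n
    obtain ⟨y, rfl⟩ := hx n
    exact ⟨T y, by rw [← mul_apply_eq_comp, ← mul_apply_eq_comp,
      ← pow_succ, ← pow_succ']⟩
  -- A preimage `x` of `y = T ^ (n + 1) u` differs from `T ^ n u` by a kernel vector, which
  -- semi-regularity puts in the range of `T ^ n`.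
  have hsurj : Function.Surjective (T.restrict hmaps) := by
    rintro ⟨y, hy⟩
    rw [hmemK] at hy
    obtain ⟨x, hx⟩ := hy 1
    rw [pow_one] at hx
    refine ⟨⟨x, (hmemK x).2 fun n => ?_⟩, Subtype.ext hx⟩
    obtain ⟨u, hu⟩ := hy (n + 1)
    rw [pow_succ', mul_apply_eq_comp] at hu
    obtain ⟨v, hv⟩ := h.2 (x - (T ^ n) u) (by rw [map_sub, hx, hu, sub_self]) n
    exact ⟨v + u, by rw [map_add, hv, sub_add_cancel]⟩
  have hinj := (hT.of_intertwining K.subtypeL Subtype.val_injective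
    (S := T.restrict hmaps) fun _ => rfl).injective_of_surjective hsurj
  refine (injective_iff_map_eq_zero T).2 fun x hx => ?_
  have hxK : x ∈ K := (hmemK x).2 fun n => h.2 x hx n
  exact congrArg Subtype.val (@hinj ⟨x, hxK⟩ 0 (Subtype.ext (by simpa using hx)))

/-- A semi-regular operator which has, with its adjoint, the SVEP at `0` is bijective. -/
theorem IsSemiRegular.bijective [CompleteSpace E] {T : E →L[ℂ] E} (h : IsSemiRegular T)
    (hT : HasSVEPAt T 0) (hT' : HasSVEPAt (adjoint T) 0) : Function.Bijective T := by
  have hinj := h.injective hT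
  refine ⟨hinj, ?_⟩
  have hR : IsClosed (T.range : Set E) := h.1
  -- `T` is an isomorphism onto its closed range, so a functional transports there and extends by
  -- Hahn–Banach.
  have hadj : Function.Surjective (adjoint T) := fun φ => by
    let e := T.equivRange hinj h.1
    obtain ⟨ψ, hψ⟩ := StrongDual.exists_extension T.range (φ ∘L e.symm.toContinuousLinearMap)
    refine ⟨ψ, ContinuousLinearMap.ext fun x => ?_⟩
    have := hψ ⟨T x, by simp⟩
    simpa [e, adjoint] using this
  have hadji := hT'.injective_of_surjective hadj
  by_contra hs
  obtain ⟨y, hy⟩ := not_forall.1 hs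
  have hy' : T.range.mkQL y ≠ 0 := by
    simpa [Submodule.Quotient.mk_eq_zero] using hy
  obtain ⟨φ, hφ⟩ := SeparatingDual.exists_ne_zero (R := ℂ) hy'
  have h0 : φ ∘L T.range.mkQL = 0 := hadji <| by
    ext x
    have : T.range.mkQL (T x) = 0 := by simp
    simp only [adjoint, ContinuousLinearMap.precomp_apply, ContinuousLinearMap.comp_apply, this,
      map_zero, zero_apply]
  exact hφ (DFunLike.congr_fun h0 y)

/-! ### Pseudo-Fredholm operators and accumulation points of the spectrum -/

theorem isUnit_sub_smul_one_iff {A : Type*} [Ring A] [Algebra ℂ A] {a : A} {z : ℂ} :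
    IsUnit (a - z • (1 : A)) ↔ z ∈ resolventSet ℂ a := by
  rw [spectrum.mem_resolventSet_iff, ← IsUnit.neg_iff, neg_sub, Algebra.algebraMap_eq_smul_one]

theorem IsQuasinilpotent.mem_resolventSet {T : E →L[ℂ] E} (h : IsQuasinilpotent T) {z : ℂ}
    (hz : z ≠ 0) : z ∈ resolventSet ℂ T := by
  by_contra hs
  have : (‖z‖₊ : ENNReal) ≤ spectralRadius ℂ T :=
    le_iSup₂ (f := fun (k : ℂ) (_ : k ∈ spectrum ℂ T) => (‖k‖₊ : ENNReal)) z hs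
  rw [h] at this
  simp [hz] at this

theorem isQuasinilpotent_of_norm_pow_le [CompleteSpace E] {T : E →L[ℂ] E}
    (h : ∀ ε > 0, ∃ C : ℝ, ∀ n : ℕ, ‖T ^ n‖ ≤ C * ε ^ n) : IsQuasinilpotent T := by
  have key : ∀ z ∈ spectrum ℂ T, z = 0 := fun z hz => by
    by_contra hz0
    have hz' : 0 < ‖z‖ := norm_pos_iff.2 hz0
    -- Since `z ^ n` lies in the spectrum of `T ^ n`, any rate below `‖z‖` is contradictory.
    obtain ⟨C, hC⟩ := h (‖z‖ / 2) (by positivity)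
    have hlim : Tendsto (fun n : ℕ => C * ‖(1 : E →L[ℂ] E)‖ * (1 / 2 : ℝ) ^ n) atTop (𝓝 0) := by
      simpa using (tendsto_pow_atTop_nhds_zero_of_lt_one (r := (1 / 2 : ℝ)) (by norm_num)
        (by norm_num)).const_mul (C * ‖(1 : E →L[ℂ] E)‖)
    have : (1 : ℝ) ≤ 0 := ge_of_tendsto' hlim fun n => by
      have h1 := spectrum.norm_le_norm_mul_of_mem (spectrum.pow_mem_pow T n hz)
      have h2 := h1.trans (mul_le_mul_of_nonneg_right (hC n) (norm_nonneg _))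
      rw [norm_pow, div_pow] at h2
      have h3 : 0 < ‖z‖ ^ n := by positivity
      refine le_of_mul_le_mul_right ?_ h3
      rw [one_mul]
      refine h2.trans_eq ?_
      rw [div_pow, one_pow]
      ring
    linarith
  refine le_antisymm (iSup₂_le fun z hz => ?_) bot_le
  simp [key z hz]

theorem exists_restrict_sub_smul_one {T : E →L[ℂ] E} {M : Submodule ℂ E}
    (hM : ∀ x ∈ M, T x ∈ M) (z : ℂ) :
    ∃ h : ∀ x ∈ M, (T - z • (1 : E →L[ℂ] E)) x ∈ M,
      (T - z • (1 : E →L[ℂ] E)).restrict h = T.restrict hM - z • (1 : M →L[ℂ] M) :=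
  ⟨fun x hx => M.sub_mem (hM x hx) (M.smul_mem z hx),
    ContinuousLinearMap.ext fun _ => Subtype.ext rfl⟩

/-- Bijectivity of an operator can be checked on complementary invariant subspaces. -/
theorem bijective_of_isCompl {T : E →L[ℂ] E} {M N : Submodule ℂ E} (hMN : IsCompl M N)
    (hM : ∀ x ∈ M, T x ∈ M) (hN : ∀ x ∈ N, T x ∈ N)
    (hbM : Function.Bijective (T.restrict hM)) (hbN : Function.Bijective (T.restrict hN)) :
    Function.Bijective T := by
  have hdec : ∀ x : E, ∃ m : M, ∃ n : N, (m : E) + n = x := fun x => by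
    obtain ⟨m, hm, n, hn, h⟩ := Submodule.mem_sup.1 (hMN.sup_eq_top ▸ Submodule.mem_top (x := x))
    exact ⟨⟨m, hm⟩, ⟨n, hn⟩, h⟩
  constructor
  · refine (injective_iff_map_eq_zero T).2 fun x hx => ?_
    obtain ⟨m, n, rfl⟩ := hdec x
    rw [map_add] at hx
    have h1 : T m ∈ M ⊓ N := ⟨hM _ m.2, by
      rw [eq_neg_of_add_eq_zero_left hx]; exact N.neg_mem (hN _ n.2)⟩
    rw [hMN.inf_eq_bot, Submodule.mem_bot] at h1
    have h2 : T n = 0 := by rwa [h1, zero_add] at hx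
    have h3 : m = 0 := hbM.1 (a₂ := 0) (Subtype.ext (by simpa using h1))
    have h4 : n = 0 := hbN.1 (a₂ := 0) (Subtype.ext (by simpa using h2))
    simp [h3, h4]
  · intro y
    obtain ⟨m, n, rfl⟩ := hdec y
    obtain ⟨m', hm'⟩ := hbM.2 m
    obtain ⟨n', hn'⟩ := hbN.2 n
    refine ⟨m' + n', ?_⟩
    rw [map_add, ← hm', ← hn']
    rfl

/-- The dual of the surjection `P` is injective and intertwines the adjoints of `S` and `T`. -/
theorem HasSVEPAt.adjoint_of_semiconj {T : E →L[ℂ] E} {S : F →L[ℂ] F} {z₀ : ℂ}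
    (hT : HasSVEPAt (adjoint T) z₀) (P : E →L[ℂ] F) (hP : Function.Surjective P)
    (hPT : ∀ x, P (T x) = S (P x)) : HasSVEPAt (adjoint S) z₀ := by
  let J : StrongDual ℂ F →L[ℂ] StrongDual ℂ E := P.precomp ℂ
  refine hT.of_intertwining J (fun φ ψ hφψ => ContinuousLinearMap.ext fun y => ?_)
    fun φ => ContinuousLinearMap.ext fun x => ?_
  · obtain ⟨x, rfl⟩ := hP y
    exact DFunLike.congr_fun hφψ x
  · exact congrArg φ (hPT x).symm

/-- If `T` and its adjoint have the SVEP at `0` and `T` is pseudo-Fredholm, then `0` is not an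
accumulation point of the spectrum of `T`. -/
theorem IsPseudoFredholm.eventually_mem_resolventSet [CompleteSpace E] {T : E →L[ℂ] E}
    (h : IsPseudoFredholm T) (hT : HasSVEPAt T 0) (hT' : HasSVEPAt (adjoint T) 0) :
    ∀ᶠ z : ℂ in 𝓝[≠] 0, z ∈ resolventSet ℂ T := by
  obtain ⟨M, N, hM, hN, hMc, hNc, hMN, hsr, hqn⟩ := h
  have := hMc.completeSpace_coe
  have := hNc.completeSpace_coe
  have htop := Submodule.IsCompl.isTopCompl_of_isClosed hMN hMc hNc
  let P : E →L[ℂ] M := M.projectionOntoL N htop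
  have hPM : ∀ m : M, P m = m := Submodule.projectionOntoL_apply_left htop
  have hPN : ∀ n ∈ N, P n = 0 := fun n hn => Submodule.projectionOntoL_apply_right htop ⟨n, hn⟩
  have hPT : ∀ x, P (T x) = T.restrict hM (P x) := fun x => by
    obtain ⟨m, hm, n, hn, rfl⟩ :=
      Submodule.mem_sup.1 (hMN.sup_eq_top ▸ Submodule.mem_top (x := x))
    have h1 : P m = ⟨m, hm⟩ := hPM ⟨m, hm⟩
    have h2 : P (T m) = ⟨T m, hM hm⟩ := hPM ⟨T m, hM hm⟩
    rw [map_add, map_add, map_add, hPN n hn, hPN _ (hN hn), add_zero, add_zero, h1, h2]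
    rfl
  have hbij : Function.Bijective (T.restrict hM) :=
    hsr.bijective (hT.of_intertwining M.subtypeL Subtype.val_injective fun _ => rfl)
      (hT'.adjoint_of_semiconj P (fun m => ⟨m, hPM m⟩) hPT)
  have h0 : (0 : ℂ) ∈ resolventSet ℂ (T.restrict hM) := by
    rw [← isUnit_sub_smul_one_iff, zero_smul, sub_zero]
    exact ContinuousLinearMap.isUnit_iff_bijective.2 hbij
  have hnear : ∀ᶠ z : ℂ in 𝓝[≠] 0, z ∈ resolventSet ℂ (T.restrict hM) :=
    ((spectrum.isOpen_resolventSet (𝕜 := ℂ) (T.restrict hM)).eventually_mem h0).filter_mono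
      nhdsWithin_le_nhds
  have hne : ∀ᶠ z : ℂ in 𝓝[≠] 0, z ≠ 0 := eventually_mem_nhdsWithin
  refine (hnear.and hne).mono fun z ⟨hzM, hz⟩ => ?_
  have hzN := hqn.mem_resolventSet hz
  rw [← isUnit_sub_smul_one_iff, ContinuousLinearMap.isUnit_iff_bijective] at hzM hzN ⊢
  obtain ⟨hM', eM⟩ := exists_restrict_sub_smul_one hM z
  obtain ⟨hN', eN⟩ := exists_restrict_sub_smul_one hN z
  exact bijective_of_isCompl hMN hM' hN' (eM ▸ hzM) (eN ▸ hzN)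

/-- If `0` is not an accumulation point of the spectrum, the operator is pseudo-Fredholm. -/
theorem isPseudoFredholm_of_eventually [CompleteSpace E] {T : E →L[ℂ] E}
    (h : ∀ᶠ z : ℂ in 𝓝[≠] 0, z ∈ resolventSet ℂ T) : IsPseudoFredholm T := by
  obtain ⟨p, s, hTp, hTs, hpp, hps, hTsp, hbound⟩ := exists_riesz_idempotent h
  have e1 : ∀ x, T (p x) = p (T x) := fun x => DFunLike.congr_fun hTp.eq x
  have e2 : ∀ x, T (s x) = s (T x) := fun x => DFunLike.congr_fun hTs.eq x
  have e3 : ∀ x, p (p x) = p x := fun x => DFunLike.congr_fun hpp x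
  have e4 : ∀ x, p (s x) = 0 := fun x => DFunLike.congr_fun hps x
  have e5 : ∀ x, T (s x) = p x - x := fun x => DFunLike.congr_fun hTsp x
  let M : Submodule ℂ E := p.ker
  let N : Submodule ℂ E := (1 - p).ker
  have mM : ∀ x, x ∈ M ↔ p x = 0 := fun x => Iff.rfl
  have mN : ∀ x, x ∈ N ↔ p x = x := fun x => by
    simp only [N, LinearMap.mem_ker, ContinuousLinearMap.coe_coe, sub_apply,
      one_apply_eq_self, sub_eq_zero]
    exact eq_comm
  have hM : Set.MapsTo T M M := fun x hx => (mM _).2 <| by rw [← e1, (mM x).1 hx, map_zero]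
  have hN : Set.MapsTo T N N := fun x hx => (mN _).2 <| by rw [← e1, (mN x).1 hx]
  have hNc : IsClosed (N : Set E) := (1 - p).isClosed_ker
  have := hNc.completeSpace_coe
  refine ⟨M, N, hM, hN, p.isClosed_ker, hNc, ⟨?_, ?_⟩, ?_, ?_⟩
  · rw [Submodule.disjoint_def]
    exact fun x hx hx' => by rw [← (mN x).1 hx', (mM x).1 hx]
  · rw [codisjoint_iff, Submodule.eq_top_iff']
    refine fun x => Submodule.mem_sup.2 ⟨x - p x, ?_, p x, (mN _).2 (e3 x), by abel⟩
    rw [mM, map_sub, e3, sub_self]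
  -- On the kernel of `p`, the identity `T s = p - 1` makes `-s` an inverse of `T`.
  · have hsurj : Function.Surjective (T.restrict hM) := fun ⟨y, hy⟩ => by
      refine ⟨⟨-s y, (mM _).2 (by rw [map_neg, e4, neg_zero])⟩, Subtype.ext ?_⟩
      change T (-s y) = y
      rw [map_neg, e5, (mM y).1 hy, zero_sub, neg_neg]
    refine ⟨by rw [hsurj.range_eq]; exact isClosed_univ, ?_⟩
    rintro ⟨x, hx⟩ h0 n
    have hTx : T x = 0 := congrArg Subtype.val h0
    have hx0 : x = 0 := by
      have := e5 x
      rw [e2, hTx, map_zero, (mM x).1 hx, zero_sub] at this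
      exact neg_eq_zero.1 this.symm
    subst hx0
    exact ⟨0, map_zero _⟩
  · refine isQuasinilpotent_of_norm_pow_le fun ε hε => ?_
    obtain ⟨C, hC, hCb⟩ := hbound ε hε
    have hpow : ∀ (n : ℕ) (x : N), (((T.restrict hN) ^ n) x : E) = (T ^ n) x := fun n x => by
      induction n with
      | zero => rfl
      | succ n ih =>
        rw [pow_succ', pow_succ', mul_apply_eq_comp, mul_apply_eq_comp, ← ih]
        rfl
    refine ⟨C, fun n => ContinuousLinearMap.opNorm_le_bound _ (by positivity) fun x => ?_⟩
    have hx : (T ^ n) x = (T ^ n * p) x := by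
      rw [mul_apply_eq_comp, (mN x).1 x.2]
    rw [Submodule.coe_norm, hpow, hx]
    exact (ContinuousLinearMap.le_of_opNorm_le _ (hCb n) _)

theorem isPseudoFredholm_iff_eventually [CompleteSpace E] {T : E →L[ℂ] E}
    (hT : HasSVEPAt T 0) (hT' : HasSVEPAt (adjoint T) 0) :
    IsPseudoFredholm T ↔ ∀ᶠ z : ℂ in 𝓝[≠] 0, IsUnit (T - z • (1 : E →L[ℂ] E)) := by
  simp only [isUnit_sub_smul_one_iff]
  exact ⟨fun h => h.eventually_mem_resolventSet hT hT', isPseudoFredholm_of_eventually⟩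

/-! ### Upper triangular operator matrices -/

theorem adjoint_sub_smul_one (T : E →L[ℂ] E) (z : ℂ) :
    adjoint (T - z • (1 : E →L[ℂ] E)) = adjoint T - z • (1 : StrongDual ℂ E →L[ℂ] StrongDual ℂ E) := by
  refine ContinuousLinearMap.ext fun φ => ContinuousLinearMap.ext fun x => ?_
  change φ (T x - z • x) = φ (T x) - z • φ x
  rw [map_sub, map_smul]

theorem upperTriangular_sub_smul_one (A : E →L[ℂ] E) (B : F →L[ℂ] F) (C : F →L[ℂ] E) (z : ℂ) :
    upperTriangular A B C - z • (1 : (E × F) →L[ℂ] (E × F)) =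
      upperTriangular (A - z • (1 : E →L[ℂ] E)) (B - z • (1 : F →L[ℂ] F)) C := by
  refine ContinuousLinearMap.ext fun x => ?_
  simp only [upperTriangular, sub_apply, smul_apply, one_apply_eq_self,
    ContinuousLinearMap.prod_apply, ContinuousLinearMap.coprod_apply,
    ContinuousLinearMap.comp_apply, ContinuousLinearMap.coe_snd']
  ext <;> simp
  abel

theorem HasSVEP.upperTriangular {A : E →L[ℂ] E} {B : F →L[ℂ] F} (hA : HasSVEP A)
    (hB : HasSVEP B) (C : F →L[ℂ] E) : HasSVEP (upperTriangular A B C) :=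
  fun z₀ U hU hz f hf hfz => by
  simp only [upperTriangular_sub_smul_one] at hfz
  have h2 : ∀ z ∈ U, (f z).2 = 0 := hB z₀ U hU hz _
    (fun z hz => (ContinuousLinearMap.snd ℂ E F).analyticAt _ |>.comp (hf z hz))
    (fun z hz => congrArg Prod.snd (hfz z hz))
  have h1 : ∀ z ∈ U, (f z).1 = 0 := hA z₀ U hU hz _
    (fun z hz => (ContinuousLinearMap.fst ℂ E F).analyticAt _ |>.comp (hf z hz))
    (fun z hz => by
      have := congrArg Prod.fst (hfz z hz)
      simpa [GenKato.upperTriangular, h2 z hz] using this)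
  exact fun z hz => Prod.ext (h1 z hz) (h2 z hz)

/-- The adjoint matrix is lower triangular: the restriction of `f z` to `E` is handled first by
`A*`, and once it vanishes the `C` term drops out and `B*` handles the rest. -/
theorem HasSVEP.adjoint_upperTriangular {A : E →L[ℂ] E} {B : F →L[ℂ] F}
    (hA : HasSVEP (adjoint A)) (hB : HasSVEP (adjoint B)) (C : F →L[ℂ] E) :
    HasSVEP (adjoint (GenKato.upperTriangular A B C)) := fun z₀ U hU hz₀ f hf hfz => by
  let i : StrongDual ℂ (E × F) →L[ℂ] StrongDual ℂ E := (ContinuousLinearMap.inl ℂ E F).precomp ℂ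
  let j : StrongDual ℂ (E × F) →L[ℂ] StrongDual ℂ F := (ContinuousLinearMap.inr ℂ E F).precomp ℂ
  have hM : ∀ z ∈ U, ∀ x y, f z ((A - z • (1 : E →L[ℂ] E)) x + C y,
      (B - z • (1 : F →L[ℂ] F)) y) = 0 := fun z hz x y => by
    have := hfz z hz
    rw [← adjoint_sub_smul_one, upperTriangular_sub_smul_one] at this
    exact DFunLike.congr_fun this (x, y)
  have h1 : ∀ z ∈ U, ∀ x, f z (x, 0) = 0 := fun z hz => DFunLike.congr_fun <| hA z₀ U hU hz₀
    (fun z => i (f z))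
    (fun z hz => (i.analyticAt _).comp (hf z hz))
    (fun z hz => by
      rw [← adjoint_sub_smul_one]
      ext x
      change f z ((A - z • (1 : E →L[ℂ] E)) x, 0) = 0
      simpa only [map_zero, add_zero] using hM z hz x 0) z hz
  have h2 : ∀ z ∈ U, ∀ y, f z (0, y) = 0 := fun z hz => DFunLike.congr_fun <| hB z₀ U hU hz₀
    (fun z => j (f z))
    (fun z hz => (j.analyticAt _).comp (hf z hz))
    (fun z hz => by
      rw [← adjoint_sub_smul_one]
      ext y
      change f z (0, (B - z • (1 : F →L[ℂ] F)) y) = 0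
      have := hM z hz 0 y
      rwa [map_zero, zero_add, ← add_zero (C y), ← zero_add ((B - z • (1 : F →L[ℂ] F)) y),
        ← Prod.mk_add_mk, map_add, h1 z hz, zero_add] at this) z hz
  intro z hz
  ext x
  · exact h1 z hz x
  · exact h2 z hz x

/-- Bijectivity of the matrix directly gives only `A` injective and `B` surjective. The SVEP makes
`B` injective, so preimages of `(x, 0)` have second entry `0` and `A` is onto. -/
theorem isUnit_upperTriangular_iff [CompleteSpace E] [CompleteSpace F]
    {A : E →L[ℂ] E} {B : F →L[ℂ] F} (hB : HasSVEPAt B 0) (C : F →L[ℂ] E) :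
    IsUnit (upperTriangular A B C) ↔ IsUnit A ∧ IsUnit B := by
  have hM : ∀ x y, upperTriangular A B C (x, y) = (A x + C y, B y) := fun x y => rfl
  simp only [ContinuousLinearMap.isUnit_iff_bijective]
  constructor
  · rintro ⟨hi, hs⟩
    have hBs : Function.Surjective B := fun y => by
      obtain ⟨⟨u, v⟩, h⟩ := hs (0, y)
      exact ⟨v, congrArg Prod.snd h⟩
    have hBi := hB.injective_of_surjective hBs
    refine ⟨⟨fun x x' h => ?_, fun x => ?_⟩, hBi, hBs⟩
    · exact congrArg Prod.fst (@hi (x, 0) (x', 0) (by rw [hM, hM, h]))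
    · obtain ⟨⟨u, v⟩, h⟩ := hs (x, 0)
      rw [hM, Prod.mk.injEq] at h
      have hv : v = 0 := hBi (h.2.trans (map_zero B).symm)
      exact ⟨u, by simpa [hv] using h.1⟩
  · rintro ⟨⟨hAi, hAs⟩, hBi, hBs⟩
    refine ⟨?_, ?_⟩
    · rintro ⟨u, v⟩ ⟨u', v'⟩ h
      rw [hM, hM, Prod.mk.injEq] at h
      have hv := hBi h.2
      subst hv
      rw [hAi (add_right_cancel h.1)]
    · rintro ⟨x, y⟩
      obtain ⟨v, rfl⟩ := hBs y
      obtain ⟨u, hu⟩ := hAs (x - C v)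
      exact ⟨(u, v), by rw [hM, hu, sub_add_cancel]⟩

theorem isPseudoFredholm_upperTriangular_iff [CompleteSpace E] [CompleteSpace F]
    {A : E →L[ℂ] E} {B : F →L[ℂ] F} (hA : HasSVEP A) (hA' : HasSVEP (adjoint A))
    (hB : HasSVEP B) (hB' : HasSVEP (adjoint B)) (C : F →L[ℂ] E) :
    IsPseudoFredholm (upperTriangular A B C) ↔ IsPseudoFredholm A ∧ IsPseudoFredholm B := by
  rw [isPseudoFredholm_iff_eventually (hA.upperTriangular hB C 0)
      (hA'.adjoint_upperTriangular hB' C 0),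
    isPseudoFredholm_iff_eventually (hA 0) (hA' 0), isPseudoFredholm_iff_eventually (hB 0) (hB' 0),
    ← eventually_and]
  simp only [upperTriangular_sub_smul_one, isUnit_upperTriangular_iff (hB.sub_smul_one _ 0)]

end GenKato

theorem mainTheorem4 {X Y : Type*}
    [NormedAddCommGroup X] [NormedSpace ℂ X] [CompleteSpace X]
    [NormedAddCommGroup Y] [NormedSpace ℂ Y] [CompleteSpace Y]
    (A : X →L[ℂ] X) (B : Y →L[ℂ] Y)
    (hA : GenKato.HasSVEP A) (hA' : GenKato.HasSVEP (GenKato.adjoint A))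
    (hB : GenKato.HasSVEP B) (hB' : GenKato.HasSVEP (GenKato.adjoint B))
    (C : Y →L[ℂ] X) :
    GenKato.gKSpectrum (GenKato.upperTriangular A B C) =
      GenKato.gKSpectrum A ∪ GenKato.gKSpectrum B := by
  ext z
  have := GenKato.isPseudoFredholm_upperTriangular_iff (hA.sub_smul_one z)
    (GenKato.adjoint_sub_smul_one A z ▸ hA'.sub_smul_one z) (hB.sub_smul_one z)
    (GenKato.adjoint_sub_smul_one B z ▸ hB'.sub_smul_one z) C
  simp only [GenKato.gKSpectrum, Set.mem_ofPred_eq, Set.mem_union,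
    GenKato.upperTriangular_sub_smul_one, this, not_and_or]
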